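/- Let $\mathcal X$ be a finite or countably infinite set of uncorrupted inputs, $\mathcal Z$ a set of corrupted inputs, $l\in\mathbb N$, $[l]=\{1,\dots,l\}$, and $\mathcal H\subseteq [l]^{\mathcal Z}$ a hypothesis class. A finite set $S\subseteq\mathcal Z$ is G-shattered by $\mathcal H$ if there is $f:S\to[l]$ such that for every $T\subseteq S$ some $g\in\mathcal H$ satisfies $g(z)=f(z)$ for all $z\in T$ and $g(z)\ne f(z)$ for all $z\in S\setminus T$; the graph dimension $d_G(\mathcal H)$ is the supremum of the cardinalities of the G-shattered finite sets. Let $k\ge 2$ and let $\rho$ assign to every $x\in\mathcal X$ a non-empty set $\rho(x)\subseteq\mathcal Z$ of at most $k$ possible corruptions. Let $c^*:\mathcal X\to[l]$ be the target function and $D$ a probability distribution on $\mathcal X$. Let $\Delta(\mathcal H)$ be the set of finite mixtures $\tilde h=(\alpha_t,h_t)_{t=1}^T$ with $h_t\in\mathcal H$, $\alpha_t\in[0,1]$ and $\sum_{t}\alpha_t=1$, with loss $\mathsf{loss}(\tilde h(z),y)=\sum_{t=1}^T\alpha_t\,\mathbb I_{\{h_t(z)\neq y\}}$. For $\tilde h\in\Delta(\mathcal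 H)$ and a sample $S=\big((x_1,c^*(x_1)),\dots,(x_m,c^*(x_m))\big)$ with $x_1,\dots,x_m$ drawn i.i.d. from $D$ put $$\operatorname{Risk}(\tilde h)=\mathbb E_{x\sim D}\Big[\max_{z\in\rho(x)}\mathsf{loss}(\tilde h(z),c^*(x))\Big],\qquad \widehat{\operatorname{Risk}}(\tilde h)=\frac1m\sum_{i=1}^m\max_{z\in\rho(x_i)}\mathsf{loss}(\tilde h(z),c^*(x_i)).$$ Theorem. There is an absolute constant $C>0$ such that for all $\mathcal X,\mathcal Z,l,\mathcal H,k,\rho,c^*,D$ as above with $d_G(\mathcal H)<\infty$, all $\epsilon>0$ and $\delta\in(0,1)$ (where, if $d_G(\mathcal H)=0$, moreover $\delta\le\tfrac12$), and every sample size $$m\ \ge\ \frac{C}{\epsilon^2}\Big(k\log (k)\,d_G(\mathcal H)+\log\frac1\delta\Big),$$ with probability at least $1-\delta$ over the sample, $|\operatorname{Risk}(\tilde h)-\widehat{\operatorname{Risk}}(\tilde h)|\le\epsilon$ holds simultaneously for every $\tilde h\in\Delta(\mathcal H)$. -/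

import Mathlib

open MeasureTheory

noncomputable section

namespace AdvRobust

/-- `H` G-shatters the finite set `S`: there is a labelling `f` of `S` such that for every `T ⊆ S`
some `g ∈ H` agrees with `f` on `T` and disagrees with `f` at every point of `S \ T`. -/
def GShatters {Z : Type*} {l : ℕ} (H : Set (Z → Fin l)) (S : Finset Z) : Prop :=
  ∃ f : S → Fin l, ∀ T ⊆ S, ∃ g ∈ H, ∀ z : S, (z.1 ∈ T → g z.1 = f z) ∧ (z.1 ∉ T → g z.1 ≠ f z)

/-- The graph dimension: the supremum of the cardinalities of the G-shattered finite sets. -/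
def graphDim {Z : Type*} {l : ℕ} (H : Set (Z → Fin l)) : ℕ∞ :=
  ⨆ (S : Finset Z) (_ : GShatters H S), (S.card : ℕ∞)

/-- The zero-one loss. -/
def zeroOneLoss {l : ℕ} (y' y : Fin l) : ℝ := if y' ≠ y then 1 else 0

/-- A finite mixture of hypotheses from `H`: hypotheses `h 0, …, h (T - 1)` of `H` with weights
`α t ∈ [0, 1]` that sum to one. (In particular `T` is positive.) -/
structure Mixture {Z : Type*} {l : ℕ} (H : Set (Z → Fin l)) where
  T : ℕ
  α : Fin T → ℝ
  h : Fin T → Z → Fin l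
  α_mem : ∀ t, α t ∈ Set.Icc (0 : ℝ) 1
  α_sum : ∑ t, α t = 1
  h_mem : ∀ t, h t ∈ H

/-- The loss of a mixture at the corrupted input `z` with respect to the label `y`. -/
def Mixture.loss {Z : Type*} {l : ℕ} {H : Set (Z → Fin l)} (q : Mixture H) (z : Z) (y : Fin l) : ℝ :=
  ∑ t, q.α t * zeroOneLoss (q.h t z) y

/-- The adversarial loss at the uncorrupted input `x`, whose possible corruptions are the elements
of `ρ x` and whose label is `c x`: the maximum over `z ∈ ρ x` of the loss of the mixture. -/
def advLoss {X Z : Type*} {l : ℕ} {H : Set (Z → Fin l)} (ρ : X → Finset Z)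
    (hρ : ∀ x, (ρ x).Nonempty) (c : X → Fin l) (q : Mixture H) (x : X) : ℝ :=
  (ρ x).sup' (hρ x) fun z => q.loss z (c x)

/-- The adversarial risk under the distribution `D` of the uncorrupted inputs. -/
def risk {X Z : Type*} [MeasurableSpace X] {l : ℕ} {H : Set (Z → Fin l)} (D : Measure X)
    (ρ : X → Finset Z) (hρ : ∀ x, (ρ x).Nonempty) (c : X → Fin l) (q : Mixture H) : ℝ :=
  ∫ x, advLoss ρ hρ c q x ∂D

/-- The empirical adversarial risk on the sample `(s 0, c (s 0)), …, (s (m - 1), c (s (m - 1)))`. -/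
def empRisk {X Z : Type*} {l m : ℕ} {H : Set (Z → Fin l)}
    (ρ : X → Finset Z) (hρ : ∀ x, (ρ x).Nonempty) (c : X → Fin l) (s : Fin m → X)
    (q : Mixture H) : ℝ :=
  (1 / (m : ℝ)) * ∑ i, advLoss ρ hρ c q (s i)

end AdvRobust

end

/-!
The uniform deviation of the adversarial risk is controlled through Rademacher averages.

Write `φ q x` for the adversarial loss of the mixture `q` at `x`, and `v q x` for the vector of the
losses of `q` at the at most `k` corruptions of `x`. Changing one sample point changes
`sup_q ∑ i, (E φ q - φ q (s i))` by at most `1`, so by McDiarmid's inequality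
(`measureReal_add_le_bounded_differences`) it exceeds its expectation by `m ε / 2` only with
probability `exp (-m ε ^ 2 / 2)`. The same applies to `-φ`, and it remains to bound the expectation.

The maximum over the corruptions makes `φ q x` Lipschitz in `v q x` for the Euclidean norm, so
after symmetrization the vector contraction principle replaces the single sign in front of
`φ q (s i)` by independent signs in front of the `k` coordinates of `v q (s i)`
(`integral_ciSup_sub_le_radSum` for one sample point, `integral_ciSup_sum_le` for the whole sample);
the contraction rests on Khintchine's inequality. The new process is linear in `q`. Hence its
supremum over mixtures is at most that over single hypotheses (`sum_radSum_loss_le`), that is, on the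
error patterns of `H` on the `m k` corrupted points. A set of indices shattered by these patterns
is G-shattered by `H`, so the patterns have VC dimension at most `d` (`vcDim_errorPatterns_le`).

Finally, a Rademacher process on a family of VC dimension `d` on `n` points has expected supremum
`O(√(n d))` (`integral_sup'_sum_le_of_vcDim`). This is free of logarithms, because Dudley's packing
bound (`log_card_le_of_separated`) makes the chaining increments summable. With `n = m k` the
expected deviation of the empirical mean is `O(√(k d / m))`, which the sample size makes smaller
than `ε / 2`. The factor `log k` of the sample size is used only through `log k ≥ log 2`.
-/

namespace AdvRobust

open ProbabilityTheory
open scoped symmDiff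

/-! ### Bounded functions on discrete probability spaces -/

theorem integrable_of_abs_le {Ω : Type*} [MeasurableSpace Ω] [DiscreteMeasurableSpace Ω]
    {μ : Measure Ω} [IsFiniteMeasure μ] {f : Ω → ℝ} {M : ℝ} (h : ∀ ω, |f ω| ≤ M) :
    Integrable f μ :=
  Integrable.of_bound (Measurable.of_discrete (f := f)).aestronglyMeasurable M
    (Filter.Eventually.of_forall fun ω => (Real.norm_eq_abs (f ω)).trans_le (h ω))

theorem abs_integral_le {Ω : Type*} [MeasurableSpace Ω]
    {μ : Measure Ω} [IsProbabilityMeasure μ] {f : Ω → ℝ} {M : ℝ} (h : ∀ ω, |f ω| ≤ M) :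
    |∫ ω, f ω ∂μ| ≤ M := by
  simpa using norm_integral_le_of_norm_le_const (μ := μ) (f := f) (Filter.Eventually.of_forall h)

/-- Fubini for the first coordinate of a finite power of a discrete probability space. -/
theorem integral_pi_succ {X : Type*} [Countable X] [MeasurableSpace X] [DiscreteMeasurableSpace X]
    (D : Measure X) [IsProbabilityMeasure D] {m : ℕ} {f : (Fin (m + 1) → X) → ℝ} {M : ℝ}
    (h : ∀ s, |f s| ≤ M) :
    ∫ s, f s ∂(Measure.pi fun _ : Fin (m + 1) => D) =
      ∫ x, ∫ s, f (Fin.cons x s) ∂(Measure.pi fun _ : Fin m => D) ∂D := by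
  have e := (measurePreserving_piFinSuccAbove (fun _ : Fin (m + 1) => D) 0).symm
  rw [← e.integral_comp', integral_prod]
  · simp [MeasurableEquiv.piFinSuccAbove, Fin.insertNthEquiv]
  · exact integrable_of_abs_le (M := M) fun p => h _

theorem integral_prod_of_abs_le {X Y : Type*} [Countable X] [MeasurableSpace X]
    [DiscreteMeasurableSpace X] [Countable Y] [MeasurableSpace Y] [DiscreteMeasurableSpace Y]
    {μ : Measure X} {ν : Measure Y} [IsProbabilityMeasure μ] [IsProbabilityMeasure ν]
    {f : X × Y → ℝ} {M : ℝ} (h : ∀ p, |f p| ≤ M) :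
    ∫ p, f p ∂(μ.prod ν) = ∫ x, ∫ y, f (x, y) ∂ν ∂μ :=
  integral_prod _ (integrable_of_abs_le h)

/-! ### The bounded differences inequality -/

/-- Hoeffding's lemma for a function whose values differ by at most `1`. -/
theorem integral_exp_sub_integral_le {X : Type*} [MeasurableSpace X]
    [DiscreteMeasurableSpace X] (D : Measure X) [IsProbabilityMeasure D] {g : X → ℝ}
    (h : ∀ x y, g x - g y ≤ 1) (t : ℝ) :
    ∫ x, Real.exp (t * (g x - ∫ y, g y ∂D)) ∂D ≤ Real.exp (t ^ 2 / 8) := by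
  obtain ⟨x₀⟩ : Nonempty X := D.nonempty_of_neZero
  have bdd : BddBelow (Set.range g) := ⟨g x₀ - 1, by
    rintro _ ⟨y, rfl⟩; linarith [h x₀ y]⟩
  have key := (hasSubgaussianMGF_of_mem_Icc (μ := D) (X := g) (a := ⨅ x, g x)
    (b := (⨅ x, g x) + 1) Measurable.of_discrete.aemeasurable
    (Filter.Eventually.of_forall fun x => ⟨ciInf_le bdd x, by
      have : Nonempty X := ⟨x₀⟩
      have : g x - 1 ≤ ⨅ y, g y := le_ciInf fun y => by linarith [h x y]
      linarith⟩)).mgf_le t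
  refine key.trans_eq ?_
  congr 1
  simp only [add_sub_cancel_left, nnnorm_one]
  norm_num
  ring

/-- The exponential moment form of McDiarmid's inequality. Integrating out one coordinate keeps
the bounded differences, so Hoeffding's lemma can be used once for each coordinate. -/
theorem integral_exp_bounded_differences {X : Type*} [Countable X] [MeasurableSpace X]
    [DiscreteMeasurableSpace X] (D : Measure X) [IsProbabilityMeasure D] (t : ℝ) :
    ∀ {m : ℕ} {f : (Fin m → X) → ℝ} {M : ℝ}, (∀ s, |f s| ≤ M) →
      (∀ s i x, f s - f (Function.update s i x) ≤ 1) →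
      ∫ s, Real.exp (t * (f s - ∫ s', f s' ∂(Measure.pi fun _ : Fin m => D)))
        ∂(Measure.pi fun _ : Fin m => D) ≤ Real.exp (m * (t ^ 2 / 8)) := by
  intro m
  induction m with
  | zero =>
    intro f M hM _
    have : ∀ s, f s = f default := fun s => congrArg f (Subsingleton.elim _ _)
    simp [this]
  | succ m ih =>
    intro f M hM hd
    have hexp : ∀ (a b : ℝ), |a| ≤ M → |b| ≤ M →
        |Real.exp (t * (a - b))| ≤ Real.exp (|t| * (M + M)) := by
      intro a b ha hb
      rw [abs_of_pos (Real.exp_pos _)]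
      refine Real.exp_le_exp.2 ((le_abs_self _).trans ?_)
      rw [abs_mul]
      exact mul_le_mul_of_nonneg_left ((abs_sub _ _).trans (add_le_add ha hb)) (abs_nonneg _)
    have hE := integral_pi_succ D hM
    have hEb := abs_integral_le (μ := Measure.pi fun _ : Fin (m + 1) => D) hM
    set E := ∫ s, f s ∂(Measure.pi fun _ : Fin (m + 1) => D)
    set g : X → ℝ := fun x => ∫ s, f (Fin.cons x s) ∂(Measure.pi fun _ : Fin m => D) with hg
    have hgb : ∀ x, |g x| ≤ M := fun x => abs_integral_le fun s => hM _
    have hgd : ∀ x y, g x - g y ≤ 1 := by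
      intro x y
      rw [hg]
      simp only
      rw [← integral_sub (integrable_of_abs_le fun s => hM _) (integrable_of_abs_le fun s => hM _)]
      refine (integral_mono ((integrable_of_abs_le fun s => hM _).sub
        (integrable_of_abs_le fun s => hM _)) (integrable_const 1) fun s => ?_).trans (by simp)
      have := hd (Fin.cons x s) 0 y
      rwa [Fin.update_cons_zero] at this
    rw [integral_pi_succ D (fun s => hexp _ _ (hM s) hEb)]
    have inner : ∀ x, ∫ s, Real.exp (t * (f (Fin.cons x s) - E)) ∂(Measure.pi fun _ : Fin m => D)
        ≤ Real.exp (t * (g x - E)) * Real.exp (m * (t ^ 2 / 8)) := by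
      intro x
      have h1 := ih (f := fun s => f (Fin.cons x s)) (M := M) (fun s => hM _) (by
        intro s i y
        have := hd (Fin.cons x s) i.succ y
        rwa [← Fin.cons_update] at this)
      calc _ = ∫ s, Real.exp (t * (g x - E)) * Real.exp (t * (f (Fin.cons x s) - g x))
            ∂(Measure.pi fun _ : Fin m => D) := by
            congr 1; ext s; rw [← Real.exp_add]; ring_nf
        _ = Real.exp (t * (g x - E)) * ∫ s, Real.exp (t * (f (Fin.cons x s) - g x))
            ∂(Measure.pi fun _ : Fin m => D) := integral_const_mul _ _
        _ ≤ _ := mul_le_mul_of_nonneg_left h1 (Real.exp_pos _).le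
    calc _ ≤ ∫ x, Real.exp (t * (g x - E)) * Real.exp (m * (t ^ 2 / 8)) ∂D := by
          refine integral_mono (integrable_of_abs_le (M := Real.exp (|t| * (M + M))) fun x =>
            abs_integral_le fun s => hexp _ _ (hM _) hEb) ?_ inner
          exact (integrable_of_abs_le fun x => hexp _ _ (hgb x) hEb).mul_const _
      _ = (∫ x, Real.exp (t * (g x - E)) ∂D) * Real.exp (m * (t ^ 2 / 8)) :=
          integral_mul_const _ _
      _ ≤ Real.exp (t ^ 2 / 8) * Real.exp (m * (t ^ 2 / 8)) := by
          refine mul_le_mul_of_nonneg_right ?_ (Real.exp_pos _).le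
          rw [hE]
          exact integral_exp_sub_integral_le D hgd t
      _ = _ := by rw [← Real.exp_add]; push_cast; ring_nf

/-- McDiarmid's inequality, for differences bounded by `1`. -/
theorem measureReal_add_le_bounded_differences {X : Type*} [Countable X] [MeasurableSpace X]
    [DiscreteMeasurableSpace X] (D : Measure X) [IsProbabilityMeasure D]
    {m : ℕ} (hm : 0 < m) {f : (Fin m → X) → ℝ} {M : ℝ} (hM : ∀ s, |f s| ≤ M)
    (hd : ∀ s i x, f s - f (Function.update s i x) ≤ 1) {a : ℝ} (ha : 0 ≤ a) :
    (Measure.pi fun _ : Fin m => D).real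
        {s | (∫ s', f s' ∂(Measure.pi fun _ : Fin m => D)) + a ≤ f s} ≤
      Real.exp (-(2 * a ^ 2 / m)) := by
  have hm' : (0 : ℝ) < m := by exact_mod_cast hm
  set P := Measure.pi fun _ : Fin m => D
  set E := ∫ s', f s' ∂P
  have hEb : |E| ≤ M := abs_integral_le hM
  -- the exponent `t` that minimises `m * t ^ 2 / 8 - t * a`
  set t : ℝ := 4 * a / m with ht
  have ht0 : 0 ≤ t := by positivity
  have hint : Integrable (fun s => Real.exp (t * (f s - E))) P := by
    refine integrable_of_abs_le (M := Real.exp (t * (M + M))) fun s => ?_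
    rw [abs_of_pos (Real.exp_pos _)]
    exact Real.exp_le_exp.2 (mul_le_mul_of_nonneg_left ((le_abs_self _).trans
      ((abs_sub _ _).trans (add_le_add (hM s) hEb))) ht0)
  have h1 := measure_ge_le_exp_mul_mgf (μ := P) (X := fun s => f s - E) a ht0 hint
  have h2 := integral_exp_bounded_differences D t hM hd
  have h3 : {s | E + a ≤ f s} = {s | a ≤ f s - E} := by
    ext s; simp only [Set.mem_ofPred_eq]; constructor <;> intro h <;> linarith
  rw [h3]
  refine h1.trans ((mul_le_mul_of_nonneg_left h2 (Real.exp_pos _).le).trans_eq ?_)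
  rw [← Real.exp_add]
  congr 1
  rw [ht]
  field_simp
  ring

/-! ### Suprema of bounded families -/

theorem bddAbove_range_of_abs_le {Q : Type*} {f : Q → ℝ} {M : ℝ} (h : ∀ q, |f q| ≤ M) :
    BddAbove (Set.range f) :=
  ⟨M, by rintro _ ⟨q, rfl⟩; exact (le_abs_self _).trans (h q)⟩

theorem le_ciSup_of_abs_le {Q : Type*} {f : Q → ℝ} {M : ℝ} (h : ∀ q, |f q| ≤ M) (q : Q) :
    f q ≤ ⨆ q, f q :=
  le_ciSup (bddAbove_range_of_abs_le h) q

theorem abs_ciSup_le {Q : Type*} [Nonempty Q] {f : Q → ℝ} {M : ℝ} (h : ∀ q, |f q| ≤ M) :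
    |⨆ q, f q| ≤ M := by
  obtain ⟨q₀⟩ := ‹Nonempty Q›
  have : Nonempty Q := ⟨q₀⟩
  exact abs_le.2 ⟨(neg_le_of_abs_le (h q₀)).trans (le_ciSup_of_abs_le h q₀),
    ciSup_le fun q => (le_abs_self _).trans (h q)⟩

theorem abs_add_le_of_le {a b A B : ℝ} (ha : |a| ≤ A) (hb : |b| ≤ B) : |a + b| ≤ A + B :=
  (abs_add_le a b).trans (add_le_add ha hb)

theorem abs_sum_fin_le {m : ℕ} {f : Fin m → ℝ} {A : ℝ} (h : ∀ i, |f i| ≤ A) :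
    |∑ i, f i| ≤ m * A :=
  (Finset.abs_sum_le_sum_abs _ _).trans
    ((Finset.sum_le_sum fun i _ => h i).trans_eq (by simp))

/-! ### Random signs -/

/-- The sign encoded by a Boolean. -/
def sgn (b : Bool) : ℝ := if b then 1 else -1

theorem abs_sgn (b : Bool) : |sgn b| = 1 := by cases b <;> simp [sgn]

theorem sgn_not (b : Bool) : sgn (!b) = -sgn b := by cases b <;> simp [sgn]

/-- The law of a fair coin. -/
noncomputable def coin : Measure Bool := (PMF.uniformOfFintype Bool).toMeasure

instance : IsProbabilityMeasure coin := by unfold coin; infer_instance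

theorem integral_coin (f : Bool → ℝ) : ∫ b, f b ∂coin = (f true + f false) / 2 := by
  rw [coin, PMF.integral_eq_sum]
  simp
  ring

theorem measurePreserving_not : MeasurePreserving (fun b : Bool => !b) coin coin := by
  refine ⟨Measurable.of_discrete, Measure.ext_of_singleton fun b => ?_⟩
  rw [Measure.map_apply Measurable.of_discrete (MeasurableSet.singleton b)]
  have : (fun b : Bool => !b) ⁻¹' {b} = {!b} := by ext c; cases b <;> cases c <;> simp
  rw [this, coin, PMF.toMeasure_apply_singleton _ _ (MeasurableSet.singleton _),
    PMF.toMeasure_apply_singleton _ _ (MeasurableSet.singleton _)]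
  simp

/-- The law of `k` independent fair coins. -/
noncomputable abbrev coins (k : ℕ) : Measure (Fin k → Bool) := Measure.pi fun _ => coin

theorem integral_coins_not {k : ℕ} (f : (Fin k → Bool) → ℝ) :
    ∫ e, f (fun j => !e j) ∂coins k = ∫ e, f e ∂coins k := by
  have h := measurePreserving_pi (fun _ : Fin k => coin) (fun _ : Fin k => coin)
    (f := fun _ b => !b) fun _ => measurePreserving_not
  refine h.integral_comp ⟨fun a b hab => ?_, Measurable.of_discrete,
    fun _ _ => (Set.toFinite _).measurableSet⟩ f
  ext j
  simpa using congrFun hab j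

/-- The Rademacher sum with coefficients `v` at the signs encoded by `e`. -/
noncomputable def radSum {k : ℕ} (v : Fin k → ℝ) (e : Fin k → Bool) : ℝ := ∑ j, sgn (e j) * v j

theorem radSum_cons {k : ℕ} (v : Fin (k + 1) → ℝ) (b : Bool) (e : Fin k → Bool) :
    radSum v (Fin.cons b e) = sgn b * v 0 + radSum (fun j => v j.succ) e := by
  simp [radSum, Fin.sum_univ_succ]

theorem radSum_not {k : ℕ} (v : Fin k → ℝ) (e : Fin k → Bool) :
    radSum v (fun j => !e j) = -radSum v e := by
  simp [radSum, sgn_not]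

theorem radSum_sub {k : ℕ} (v w : Fin k → ℝ) (e : Fin k → Bool) :
    radSum (fun j => v j - w j) e = radSum v e - radSum w e := by
  simp [radSum, mul_sub]

theorem abs_radSum_le {k : ℕ} {v : Fin k → ℝ} {B : ℝ} (h : ∀ j, |v j| ≤ B) (e : Fin k → Bool) :
    |radSum v e| ≤ k * B :=
  abs_sum_fin_le fun j => by rw [abs_mul, abs_sgn, one_mul]; exact h j

theorem integral_coins_succ {k : ℕ} (f : (Fin (k + 1) → Bool) → ℝ) :
    ∫ e, f e ∂coins (k + 1) =
      ∫ e, (f (Fin.cons true e) + f (Fin.cons false e)) / 2 ∂coins k := by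
  obtain ⟨M, hM⟩ : ∃ M, ∀ e, |f e| ≤ M :=
    ⟨∑ e, |f e|, fun e => Finset.single_le_sum (f := fun e => |f e|)
      (fun _ _ => abs_nonneg _) (Finset.mem_univ e)⟩
  rw [integral_pi_succ coin hM, integral_coin, integral_div,
    integral_add Integrable.of_finite Integrable.of_finite]

theorem integral_radSum_sq {k : ℕ} (v : Fin k → ℝ) :
    ∫ e, radSum v e ^ 2 ∂coins k = ∑ j, v j ^ 2 := by
  induction k with
  | zero => simp [radSum]
  | succ k ih =>
    rw [integral_coins_succ, Fin.sum_univ_succ, ← ih]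
    have : ∀ e : Fin k → Bool, (radSum v (Fin.cons true e) ^ 2 +
        radSum v (Fin.cons false e) ^ 2) / 2 = v 0 ^ 2 + radSum (fun j => v j.succ) e ^ 2 := by
      intro e; simp only [radSum_cons, sgn]; simp; ring
    simp_rw [this]
    rw [integral_add Integrable.of_finite Integrable.of_finite]
    simp

theorem integral_radSum_pow_four_le {k : ℕ} (v : Fin k → ℝ) :
    ∫ e, radSum v e ^ 4 ∂coins k ≤ 3 * (∑ j, v j ^ 2) ^ 2 := by
  induction k with
  | zero => simp [radSum]
  | succ k ih =>
    rw [integral_coins_succ, Fin.sum_univ_succ]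
    have h := ih fun j => v j.succ
    have h2 := integral_radSum_sq fun j => v j.succ
    have : ∀ e : Fin k → Bool, (radSum v (Fin.cons true e) ^ 4 +
        radSum v (Fin.cons false e) ^ 4) / 2 = v 0 ^ 4 +
          6 * v 0 ^ 2 * radSum (fun j => v j.succ) e ^ 2 + radSum (fun j => v j.succ) e ^ 4 := by
      intro e; simp only [radSum_cons, sgn]; simp; ring
    simp_rw [this]
    rw [integral_add Integrable.of_finite Integrable.of_finite,
      integral_add Integrable.of_finite Integrable.of_finite, integral_const_mul, h2]
    simp only [integral_const, probReal_univ, one_smul]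
    nlinarith [sq_nonneg (v 0 ^ 2)]

/-- Khintchine's inequality between the first and the second moment. -/
theorem sqrt_sum_sq_le_integral_abs_radSum {k : ℕ} (v : Fin k → ℝ) :
    √(∑ j, v j ^ 2) ≤ 2 * ∫ e, |radSum v e| ∂coins k := by
  have hnn : (0 : ℝ) ≤ ∑ j, v j ^ 2 := Finset.sum_nonneg fun _ _ => sq_nonneg _
  set σ := √(∑ j, v j ^ 2) with hσ
  have hσ2 : σ ^ 2 = ∑ j, v j ^ 2 := Real.sq_sqrt hnn
  have hσ0 : 0 ≤ σ := Real.sqrt_nonneg _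
  have hI : 0 ≤ ∫ e, |radSum v e| ∂coins k := integral_nonneg fun _ => abs_nonneg _
  rcases hσ0.eq_or_lt with h0 | hpos
  · rw [← h0]; positivity
  -- with `u = |s| / (2 σ)` this is `u (u - 1) ^ 2 (u + 2) ≥ 0`
  have pt : ∀ s : ℝ, 12 * σ ^ 2 * s ^ 2 - s ^ 4 ≤ 16 * σ ^ 3 * |s| := by
    intro s
    have h4 : s ^ 4 = |s| ^ 4 := by rw [← abs_pow, abs_of_nonneg (by positivity)]
    rw [h4, ← sq_abs s]
    have := abs_nonneg s
    have : 0 ≤ |s| * ((|s| - 2 * σ) ^ 2 * (|s| + 4 * σ)) := by positivity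
    nlinarith
  have key := integral_mono (μ := coins k) Integrable.of_finite Integrable.of_finite
    fun e => pt (radSum v e)
  rw [integral_sub Integrable.of_finite Integrable.of_finite, integral_const_mul,
    integral_const_mul, integral_radSum_sq, ← hσ2] at key
  have h4 := integral_radSum_pow_four_le v
  rw [← hσ2] at h4
  have h3 : 0 < σ ^ 3 := by positivity
  have : σ ^ 3 * (9 * σ) ≤ σ ^ 3 * (16 * ∫ e, |radSum v e| ∂coins k) := by nlinarith
  have := le_of_mul_le_mul_left this h3
  linarith

/-! ### Symmetrization and vector contraction -/

/-- The vector contraction step: a random sign in front of a function that is Lipschitz in the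
vector `v` for the Euclidean norm can be replaced by independent signs in front of the coordinates
of `v`, at the cost of the constant in Khintchine's inequality. -/
theorem ciSup_add_ciSup_le_integral_radSum {Q : Type*} [Nonempty Q] {k : ℕ} {F φ : Q → ℝ}
    {v : Q → Fin k → ℝ} {A B : ℝ} (hF : ∀ q, |F q| ≤ A) (hv : ∀ q j, |v q j| ≤ B)
    (hφ : ∀ q q', φ q - φ q' ≤ √(∑ j, (v q j - v q' j) ^ 2)) :
    (⨆ q, (F q + 2 * φ q)) + ⨆ q, (F q - 2 * φ q) ≤
      2 * ∫ e, ⨆ q, (F q + 4 * radSum (v q) e) ∂coins k := by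
  have hb : ∀ e q, |F q + 4 * radSum (v q) e| ≤ A + 4 * (k * B) := by
    intro e q
    refine abs_add_le_of_le (hF q) ?_
    rw [abs_mul, abs_of_nonneg (by norm_num : (0 : ℝ) ≤ 4)]
    exact mul_le_mul_of_nonneg_left (abs_radSum_le (hv q) e) (by norm_num)
  set G : (Fin k → Bool) → ℝ := fun e => ⨆ q, (F q + 4 * radSum (v q) e) with hG
  have main : ∀ q q', (F q + 2 * φ q) + (F q' - 2 * φ q') ≤ 2 * ∫ e, G e ∂coins k := by
    intro q q'
    have h1 := (hφ q q').trans (sqrt_sum_sq_le_integral_abs_radSum fun j => v q j - v q' j)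
    have h2 : ∀ e, F q + F q' + 4 * |radSum (fun j => v q j - v q' j) e| ≤
        G e + G (fun j => !e j) := by
      intro e
      have a := le_ciSup_of_abs_le (hb e) q
      have b := le_ciSup_of_abs_le (hb e) q'
      have c := le_ciSup_of_abs_le (hb fun j => !e j) q
      have d := le_ciSup_of_abs_le (hb fun j => !e j) q'
      simp only [radSum_not] at c d
      simp only [radSum_sub, hG, radSum_not]
      rcases abs_cases (radSum (v q) e - radSum (v q') e) with h | h <;> linarith
    have h3 := integral_mono (μ := coins k) Integrable.of_finite Integrable.of_finite h2
    have h4 : ∫ e, (G e + G fun j => !e j) ∂coins k = 2 * ∫ e, G e ∂coins k := by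
      rw [integral_add Integrable.of_finite Integrable.of_finite, integral_coins_not, two_mul]
    rw [h4, integral_add Integrable.of_finite Integrable.of_finite, integral_const_mul] at h3
    simp only [integral_const, probReal_univ, one_smul] at h3
    linarith
  refine le_sub_iff_add_le.1 (ciSup_le fun q => ?_)
  rw [le_sub_comm]
  refine ciSup_le fun q' => ?_
  linarith [main q q']

/-- Symmetrization and contraction for a single sample point. -/
theorem integral_ciSup_sub_le_radSum {Q X : Type*} [Nonempty Q] [Countable X] [MeasurableSpace X]
    [DiscreteMeasurableSpace X] (D : Measure X) [IsProbabilityMeasure D] {k : ℕ}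
    {φ : Q → X → ℝ} {v : Q → X → Fin k → ℝ} {A B C : ℝ} (hφb : ∀ q x, |φ q x| ≤ C)
    (hv : ∀ q x j, |v q x j| ≤ B)
    (hφ : ∀ q q' x, φ q x - φ q' x ≤ √(∑ j, (v q x j - v q' x j) ^ 2))
    {F : Q → ℝ} (hF : ∀ q, |F q| ≤ A) :
    ∫ x, ⨆ q, (F q + ((∫ x', φ q x' ∂D) - φ q x)) ∂D ≤
      ∫ p, ⨆ q, (F q + 4 * radSum (v q p.1) p.2) ∂(D.prod (coins k)) := by
  have hE : ∀ q, |∫ x', φ q x' ∂D| ≤ C := fun q => abs_integral_le (hφb q)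
  have h2 : ∀ q x, |2 * φ q x| ≤ 2 * C := fun q x => by
    rw [abs_mul, abs_two]; linarith [hφb q x]
  have h4 : ∀ (p : X × (Fin k → Bool)) q,
      |F q + 4 * radSum (v q p.1) p.2| ≤ A + 4 * (k * B) := by
    intro p q
    refine abs_add_le_of_le (hF q) ?_
    rw [abs_mul, abs_of_nonneg (by norm_num : (0 : ℝ) ≤ 4)]
    exact mul_le_mul_of_nonneg_left (abs_radSum_le (hv q _) _) (by norm_num)
  have hp : ∀ x q, |F q + 2 * φ q x| ≤ A + 2 * C := fun x q => abs_add_le_of_le (hF q) (h2 q x)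
  have hn : ∀ x q, |F q - 2 * φ q x| ≤ A + 2 * C := fun x q => by
    rw [sub_eq_add_neg]
    exact abs_add_le_of_le (hF q) (by rw [abs_neg]; exact h2 q x)
  have ip : Integrable (fun x => ⨆ q, (F q + 2 * φ q x)) D :=
    integrable_of_abs_le fun x => abs_ciSup_le (hp x)
  have im : Integrable (fun x => ⨆ q, (F q - 2 * φ q x)) D :=
    integrable_of_abs_le fun x => abs_ciSup_le (hn x)
  have step : ∀ x, (⨆ q, (F q + ((∫ x', φ q x' ∂D) - φ q x))) ≤
      ((∫ x', ⨆ q, (F q + 2 * φ q x') ∂D) + ⨆ q, (F q - 2 * φ q x)) / 2 := by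
    intro x
    refine ciSup_le fun q => ?_
    have a := le_ciSup_of_abs_le (hn x) q
    have b : ∫ x', (F q + 2 * φ q x') ∂D ≤ ∫ x', ⨆ q, (F q + 2 * φ q x') ∂D :=
      integral_mono (integrable_of_abs_le fun x => hp x q) ip
        fun x' => le_ciSup_of_abs_le (hp x') q
    rw [integral_add (integrable_const _) ((integrable_of_abs_le (hφb q)).const_mul _),
      integral_const_mul] at b
    simp only [integral_const, probReal_univ, one_smul] at b
    linarith
  rw [integral_prod_of_abs_le fun p => abs_ciSup_le (h4 p)]
  calc _ ≤ ∫ x, ((∫ x', ⨆ q, (F q + 2 * φ q x') ∂D) + ⨆ q, (F q - 2 * φ q x)) / 2 ∂D := by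
        refine integral_mono (integrable_of_abs_le (M := A + (C + C)) fun x =>
          abs_ciSup_le fun q => abs_add_le_of_le (hF q) ?_) ?_ step
        · rw [sub_eq_add_neg]
          exact abs_add_le_of_le (hE q) (by rw [abs_neg]; exact hφb q x)
        · exact ((integrable_const _).add im).div_const 2
    _ = ∫ x, ((⨆ q, (F q + 2 * φ q x)) + ⨆ q, (F q - 2 * φ q x)) / 2 ∂D := by
        rw [integral_div, integral_div, integral_add (integrable_const _) im, integral_add ip im]
        simp
    _ ≤ _ := by
        refine integral_mono ((ip.add im).div_const 2) (integrable_of_abs_le fun x =>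
          abs_integral_le fun e => abs_ciSup_le (h4 (x, e))) fun x => ?_
        have := ciSup_add_ciSup_le_integral_radSum (F := F) (φ := fun q => φ q x)
          (v := fun q => v q x) hF (fun q => hv q x) (fun q q' => hφ q q' x)
        simp only at this ⊢
        linarith

/-- A comparison of expected suprema that holds for one sample point, whatever bounded function is
added, holds for independent samples of any size: replace the sample points one at a time. -/
theorem integral_ciSup_sum_le {Q X Y : Type*} [Nonempty Q] [Countable X] [MeasurableSpace X]
    [DiscreteMeasurableSpace X] [Countable Y] [MeasurableSpace Y] [DiscreteMeasurableSpace Y]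
    (D : Measure X) [IsProbabilityMeasure D] (P : Measure Y) [IsProbabilityMeasure P]
    {g : Q → X → ℝ} {w : Q → Y → ℝ} {B C : ℝ} (hg : ∀ q x, |g q x| ≤ B) (hw : ∀ q y, |w q y| ≤ C)
    (h : ∀ (F : Q → ℝ) (A : ℝ), (∀ q, |F q| ≤ A) →
      ∫ x, ⨆ q, (F q + g q x) ∂D ≤ ∫ y, ⨆ q, (F q + w q y) ∂P) :
    ∀ (m : ℕ) (F : Q → ℝ) (A : ℝ), (∀ q, |F q| ≤ A) →
      ∫ s, ⨆ q, (F q + ∑ i, g q (s i)) ∂(Measure.pi fun _ : Fin m => D) ≤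
        ∫ s, ⨆ q, (F q + ∑ i, w q (s i)) ∂(Measure.pi fun _ : Fin m => P) := by
  intro m
  induction m with
  | zero => intro F A _; simp
  | succ m ih =>
    intro F A hF
    have hg' : ∀ (n : ℕ) (s : Fin n → X) q, |∑ i, g q (s i)| ≤ n * B := fun n s q =>
      abs_sum_fin_le fun i => hg q (s i)
    have hw' : ∀ (n : ℕ) (s : Fin n → Y) q, |∑ i, w q (s i)| ≤ n * C := fun n s q =>
      abs_sum_fin_le fun i => hw q (s i)
    have bgw : ∀ x (s : Fin m → Y) q, |F q + g q x + ∑ i, w q (s i)| ≤ A + B + m * C :=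
      fun x s q => abs_add_le_of_le (abs_add_le_of_le (hF q) (hg q x)) (hw' m s q)
    have bww : ∀ y (s : Fin m → Y) q, |F q + ∑ i, w q (s i) + w q y| ≤ A + m * C + C :=
      fun y s q => abs_add_le_of_le (abs_add_le_of_le (hF q) (hw' m s q)) (hw q y)
    rw [integral_pi_succ D fun s => abs_ciSup_le fun q => abs_add_le_of_le (hF q) (hg' _ s q),
      integral_pi_succ P fun s => abs_ciSup_le fun q => abs_add_le_of_le (hF q) (hw' _ s q)]
    simp only [Fin.sum_univ_succ, Fin.cons_zero, Fin.cons_succ]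
    calc _ ≤ ∫ x, ∫ s, ⨆ q, (F q + g q x + ∑ i, w q (s i)) ∂(Measure.pi fun _ : Fin m => P) ∂D := by
          refine integral_mono (integrable_of_abs_le (M := A + (B + m * B)) fun x =>
            abs_integral_le fun s => abs_ciSup_le fun q => abs_add_le_of_le (hF q)
              (abs_add_le_of_le (hg q x) (hg' m s q)))
            (integrable_of_abs_le fun x => abs_integral_le fun s => abs_ciSup_le (bgw x s))
            fun x => ?_
          have := ih (fun q => F q + g q x) (A + B) fun q => abs_add_le_of_le (hF q) (hg q x)
          simpa only [add_assoc] using this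
      _ = ∫ s, ∫ x, ⨆ q, (F q + g q x + ∑ i, w q (s i)) ∂D ∂(Measure.pi fun _ : Fin m => P) :=
          integral_integral_swap (integrable_of_abs_le (M := A + B + m * C)
            fun p => abs_ciSup_le (bgw p.1 p.2))
      _ ≤ ∫ s, ∫ y, ⨆ q, (F q + ∑ i, w q (s i) + w q y) ∂P ∂(Measure.pi fun _ : Fin m => P) := by
          refine integral_mono
            (integrable_of_abs_le fun s => abs_integral_le fun x => abs_ciSup_le (bgw x s))
            (integrable_of_abs_le fun s => abs_integral_le fun y => abs_ciSup_le (bww y s))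
            fun s => ?_
          have := h (fun q => F q + ∑ i, w q (s i)) (A + m * C)
            fun q => abs_add_le_of_le (hF q) (hw' m s q)
          simpa only [add_right_comm] using this
      _ = ∫ y, ∫ s, ⨆ q, (F q + ∑ i, w q (s i) + w q y) ∂(Measure.pi fun _ : Fin m => P) ∂P :=
          integral_integral_swap (integrable_of_abs_le (M := A + m * C + C)
            fun p => abs_ciSup_le (bww p.2 p.1))
      _ = _ := by simp only [add_assoc, add_comm (w _ _)]

/-! ### Packing numbers of families of bounded VC dimension -/

/-- A shattered set of the pulled back family is mapped injectively to a shattered set. -/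
theorem vcDim_image_preimage_le {ι κ : Type*} [DecidableEq ι] [DecidableEq κ] [Fintype κ]
    (𝒜 : Finset (Finset ι)) (p : κ → ι) :
    (𝒜.image fun s => Finset.univ.filter fun i => p i ∈ s).vcDim ≤ 𝒜.vcDim := by
  refine Finset.sup_le fun T hT => ?_
  rw [Finset.mem_shatterer] at hT
  have hinj : Set.InjOn p T := by
    intro i hi j hj hij
    by_contra hne
    obtain ⟨u, hu, hTu⟩ := hT (t := {i}) (by simpa using hi)
    obtain ⟨s, -, rfl⟩ := Finset.mem_image.1 hu
    have h1 : i ∈ T ∩ Finset.univ.filter fun i => p i ∈ s := by rw [hTu]; simp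
    have h2 : j ∈ T ∩ Finset.univ.filter fun i => p i ∈ s := by
      simp only [Finset.mem_inter, Finset.mem_filter, Finset.mem_univ, true_and] at h1 ⊢
      exact ⟨hj, hij ▸ h1.2⟩
    rw [hTu, Finset.mem_singleton] at h2
    exact hne h2.symm
  rw [← Finset.card_image_of_injOn hinj]
  refine Finset.Shatters.card_le_vcDim fun t ht => ?_
  obtain ⟨u, hu, hTu⟩ := hT (t := T.filter fun i => p i ∈ t) (Finset.filter_subset _ _)
  obtain ⟨s, hs, rfl⟩ := Finset.mem_image.1 hu
  refine ⟨s, hs, ?_⟩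
  have key : ∀ i ∈ T, (p i ∈ s ↔ p i ∈ t) := by
    intro i hi
    have := Finset.ext_iff.1 hTu i
    simpa [hi] using this
  ext x
  constructor
  · intro hx
    obtain ⟨h1, h2⟩ := Finset.mem_inter.1 hx
    obtain ⟨i, hi, rfl⟩ := Finset.mem_image.1 h1
    exact (key i hi).1 h2
  · intro hx
    obtain ⟨i, hi, rfl⟩ := Finset.mem_image.1 (ht hx)
    exact Finset.mem_inter.2 ⟨ht hx, (key i hi).2 hx⟩

theorem sum_choose_mul_pow_le (M d : ℕ) {t : ℝ} (ht : 0 ≤ t) (ht1 : t ≤ 1) :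
    (∑ i ∈ Finset.Iic d, (M.choose i : ℝ)) * t ^ d ≤ (1 + t) ^ M := by
  calc (∑ i ∈ Finset.Iic d, (M.choose i : ℝ)) * t ^ d
      ≤ ∑ i ∈ Finset.Iic d, t ^ i * (M.choose i : ℝ) := by
        rw [Finset.sum_mul]
        refine Finset.sum_le_sum fun i hi => ?_
        rw [mul_comm]
        exact mul_le_mul_of_nonneg_right (pow_le_pow_of_le_one ht ht1 (Finset.mem_Iic.1 hi))
          (Nat.cast_nonneg _)
    _ ≤ ∑ i ∈ Finset.Iic d ∪ Finset.range (M + 1), t ^ i * (M.choose i : ℝ) :=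
        Finset.sum_le_sum_of_subset_of_nonneg Finset.subset_union_left fun _ _ _ => by positivity
    _ = ∑ i ∈ Finset.range (M + 1), t ^ i * (M.choose i : ℝ) := by
        refine (Finset.sum_subset Finset.subset_union_right fun i _ hi => ?_).symm
        rw [Nat.choose_eq_zero_of_lt (by simpa [Nat.lt_succ_iff] using hi)]
        simp
    _ = (1 + t) ^ M := by rw [add_comm 1 t, add_pow]; simp

/-- If the members of `B` are pairwise separated, then some tuple of `M` points tells all of them
apart. A fixed pair is missed by a fraction of at most `exp (-η M) ≤ (#B)⁻²` of the tuples, and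
there are fewer than `(#B)²` pairs. -/
theorem exists_separating_tuple {ι : Type*} [DecidableEq ι] [Fintype ι] {B : Finset (Finset ι)}
    (hB : 1 < B.card) {η : ℝ}
    (hsep : ∀ s ∈ B, ∀ t ∈ B, s ≠ t → η * Fintype.card ι ≤ (s ∆ t).card) {M : ℕ}
    (hM : 2 * Real.log B.card ≤ η * M) :
    ∃ p : Fin M → ι, Set.InjOn (fun s : Finset ι => Finset.univ.filter fun i => p i ∈ s) B := by
  by_contra! hcon
  obtain ⟨a, -, b, -, hab⟩ := Finset.one_lt_card.1 hB
  have hn : (0 : ℝ) < Fintype.card ι := by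
    have : (a ∆ b).Nonempty := by
      rw [Finset.nonempty_iff_ne_empty]
      exact fun h => hab (symmDiff_eq_bot.1 h)
    exact_mod_cast Fintype.card_pos_iff.2 ⟨this.choose⟩
  set n : ℝ := (Fintype.card ι : ℝ) with hndef
  have hb0 : (0 : ℝ) < B.card := by exact_mod_cast (by omega : 0 < B.card)
  have hcover : (Finset.univ : Finset (Fin M → ι)) ⊆
      B.offDiag.biUnion fun st => Fintype.piFinset fun _ => (st.1 ∆ st.2)ᶜ := by
    intro p _
    have := hcon p
    simp only [Set.InjOn, not_forall] at this
    obtain ⟨s, hs, t, ht, hst, hne⟩ := this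
    refine Finset.mem_biUnion.2 ⟨(s, t), Finset.mem_offDiag.2 ⟨hs, ht, hne⟩, ?_⟩
    rw [Fintype.mem_piFinset]
    intro i
    have h1 := Finset.ext_iff.1 hst i
    simp only [Finset.mem_filter, Finset.mem_univ, true_and] at h1
    simp only [Finset.mem_compl, Finset.mem_symmDiff]
    tauto
  have hcard := (Finset.card_le_card hcover).trans Finset.card_biUnion_le
  rw [Finset.card_univ, Fintype.card_fun, Fintype.card_fin] at hcard
  have hle : ∀ st ∈ B.offDiag,
      ((Fintype.piFinset fun _ : Fin M => (st.1 ∆ st.2)ᶜ).card : ℝ) ≤ n ^ M / B.card ^ 2 := by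
    rintro ⟨s, t⟩ hst
    obtain ⟨hs, ht, hne⟩ := Finset.mem_offDiag.1 hst
    have h1 := hsep s hs t ht hne
    rw [Fintype.card_piFinset]
    simp only [Finset.prod_const, Finset.card_univ, Fintype.card_fin, Nat.cast_pow]
    have h2 : (((s ∆ t)ᶜ.card : ℕ) : ℝ) = n - (s ∆ t).card := by
      rw [Finset.card_compl, Nat.cast_sub (Finset.card_le_univ _)]
    have h3 : (((s ∆ t)ᶜ.card : ℕ) : ℝ) ≤ n * Real.exp (-η) := by
      rw [h2]
      have := Real.add_one_le_exp (-η)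
      nlinarith
    calc (((s ∆ t)ᶜ.card : ℕ) : ℝ) ^ M ≤ (n * Real.exp (-η)) ^ M :=
          pow_le_pow_left₀ (Nat.cast_nonneg _) h3 _
      _ = n ^ M * Real.exp (-(η * M)) := by
          rw [mul_pow, ← Real.exp_nat_mul]; ring_nf
      _ ≤ n ^ M * Real.exp (-(2 * Real.log B.card)) := by gcongr
      _ = n ^ M / B.card ^ 2 := by
          rw [Real.exp_neg, two_mul, Real.exp_add, Real.exp_log hb0, div_eq_mul_inv, sq]
  have hsum : (n ^ M : ℝ) ≤ B.offDiag.card * (n ^ M / B.card ^ 2) := by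
    have h1 : (n ^ M : ℝ) ≤
        ∑ st ∈ B.offDiag, ((Fintype.piFinset fun _ : Fin M => (st.1 ∆ st.2)ᶜ).card : ℝ) := by
      rw [hndef]; exact_mod_cast hcard
    exact h1.trans ((Finset.sum_le_sum hle).trans_eq (by simp))
  have hlt : (B.offDiag.card : ℝ) < B.card ^ 2 := by
    rw [Finset.offDiag_card, sq, ← Nat.cast_mul]
    exact_mod_cast Nat.sub_lt (Nat.mul_pos (by omega) (by omega)) (by omega)
  have hnM : 0 < n ^ M := pow_pos hn M
  rw [mul_div_assoc', le_div_iff₀ (by positivity)] at hsum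
  nlinarith

/-- Dudley's bound on packing numbers: the logarithm of the number of pairwise `η`-separated members
of a family of VC dimension at most `d` is `O(d log (1 / η))`. The members remain distinct on a
tuple of `O(η⁻¹ log #B)` points, where the Sauer-Shelah lemma bounds their number. -/
theorem log_card_le_of_separated {ι : Type*} [DecidableEq ι] [Fintype ι] {B : Finset (Finset ι)}
    {d : ℕ} (hd : B.vcDim ≤ d) {η : ℝ} (hη : 0 < η) (hη1 : η ≤ 1)
    (hsep : ∀ s ∈ B, ∀ t ∈ B, s ≠ t → η * Fintype.card ι ≤ (s ∆ t).card) :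
    Real.log B.card ≤ 2 * d * Real.log (8 / η) := by
  have hlog8 : 0 ≤ Real.log (8 / η) :=
    Real.log_nonneg (by rw [le_div_iff₀ hη]; linarith)
  rcases Nat.lt_or_ge 1 B.card with hB | hB
  swap
  · refine le_trans ?_ (by positivity : (0 : ℝ) ≤ 2 * d * Real.log (8 / η))
    exact Real.log_nonpos (Nat.cast_nonneg _) (by exact_mod_cast hB)
  have hb0 : (0 : ℝ) < B.card := by exact_mod_cast (by omega : 0 < B.card)
  set L := Real.log B.card with hL
  have hL2 : 1 / 2 ≤ L := by
    have h2 : Real.log 2 ≤ L := Real.log_le_log (by norm_num) (by exact_mod_cast hB)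
    linarith [Real.log_two_gt_d9]
  obtain ⟨M, hM⟩ : ∃ M : ℕ, M = ⌈2 * L / η⌉₊ := ⟨_, rfl⟩
  have hM1 : 2 * L / η ≤ M := hM ▸ Nat.le_ceil _
  have hM2 : (M : ℝ) < 2 * L / η + 1 := hM ▸ Nat.ceil_lt_add_one (by positivity)
  have hM1' : 2 * L ≤ η * M := by rwa [div_le_iff₀' hη] at hM1
  have hM2' : η * M ≤ 4 * L := by
    have : η * M ≤ η * (2 * L / η + 1) := mul_le_mul_of_nonneg_left hM2.le hη.le
    rw [mul_add, mul_div_cancel₀ _ hη.ne'] at this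
    linarith
  obtain ⟨p, hp⟩ := exists_separating_tuple hB hsep hM1'
  have hvc := (vcDim_image_preimage_le B p).trans hd
  have hsauer : B.card ≤ ∑ i ∈ Finset.Iic d, M.choose i := by
    rw [← Finset.card_image_of_injOn hp]
    refine (Finset.card_le_card_shatterer _).trans
      (Finset.card_shatterer_le_sum_vcDim.trans ?_)
    rw [Fintype.card_fin]
    exact Finset.sum_le_sum_of_subset (Finset.Iic_subset_Iic.2 hvc)
  have hsauer' : (B.card : ℝ) ≤ ∑ i ∈ Finset.Iic d, (M.choose i : ℝ) := by exact_mod_cast hsauer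
  -- this value of `t` makes `t * M` at most half of `L`
  set t : ℝ := η / 8 with ht
  have ht0 : 0 < t := by positivity
  have h1 : B.card * t ^ d ≤ Real.exp (t * M) := by
    refine (mul_le_mul_of_nonneg_right hsauer' (by positivity)).trans
      ((sum_choose_mul_pow_le M d ht0.le (by linarith)).trans ?_)
    rw [mul_comm t, Real.exp_nat_mul]
    exact pow_le_pow_left₀ (by positivity) (by linarith [Real.add_one_le_exp t]) _
  have h2 := Real.log_le_log (by positivity) h1
  rw [Real.log_exp, Real.log_mul hb0.ne' (by positivity), Real.log_pow, ← hL] at h2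
  have h3 : Real.log t = -Real.log (8 / η) := by rw [← Real.log_inv, inv_div]
  rw [h3] at h2
  have h4 : t * M ≤ L / 2 := by rw [ht]; linarith
  linarith

/-- The error patterns of the hypotheses of `H` on a family `w` of labelled points: the sets of
indices at which a hypothesis differs from the label. -/
noncomputable def errorPatterns {Z : Type*} {l : ℕ} (H : Set (Z → Fin l)) {ι : Type*} [Fintype ι]
    (w : ι → Z × Fin l) : Finset (Finset ι) := by
  classical exact Finset.univ.filter fun s => ∃ g ∈ H, ∀ i, i ∈ s ↔ g (w i).1 ≠ (w i).2

theorem mem_errorPatterns {Z : Type*} {l : ℕ} {H : Set (Z → Fin l)} {ι : Type*} [Fintype ι]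
    {w : ι → Z × Fin l} {s : Finset ι} :
    s ∈ errorPatterns H w ↔ ∃ g ∈ H, ∀ i, i ∈ s ↔ g (w i).1 ≠ (w i).2 := by
  classical simp [errorPatterns]

/-- A shattered set of indices consists of distinct points, which `H` G-shatters. -/
theorem vcDim_errorPatterns_le {Z : Type*} {l : ℕ} {H : Set (Z → Fin l)} {ι : Type*} [Fintype ι]
    [DecidableEq ι] (w : ι → Z × Fin l) {d : ℕ} (hd : graphDim H = d) :
    (errorPatterns H w).vcDim ≤ d := by
  classical
  refine Finset.sup_le fun T hT => ?_
  rw [Finset.mem_shatterer] at hT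
  have hT' : ∀ t ⊆ T, ∃ g ∈ H, ∀ i ∈ T, (i ∈ t ↔ g (w i).1 ≠ (w i).2) := by
    intro t ht
    obtain ⟨u, hu, hTu⟩ := hT ht
    obtain ⟨g, hg, hgu⟩ := mem_errorPatterns.1 hu
    refine ⟨g, hg, fun i hi => ?_⟩
    rw [← hgu i, ← hTu]
    simp [hi]
  have hinj : Set.InjOn (fun i => (w i).1) T := by
    intro i hi j hj hij
    by_contra hne
    simp only at hij
    obtain ⟨g, -, hg⟩ := hT' ∅ (Finset.empty_subset _)
    obtain ⟨g', -, hg'⟩ := hT' {i} (by simpa using hi)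
    have hi1 := hg i hi
    have hj1 := hg j hj
    have hi2 := hg' i hi
    have hj2 := hg' j hj
    simp only [Finset.notMem_empty, false_iff, not_not] at hi1 hj1
    simp only [Finset.mem_singleton, true_iff, Ne.symm hne, false_iff, not_not] at hi2 hj2
    rw [← hij] at hj1 hj2
    exact hi2 (hj2.trans (hj1.symm.trans hi1))
  have hsh : GShatters H (T.image fun i => (w i).1) := by
    have hch : ∀ z : (T.image fun i => (w i).1 : Finset Z), ∃ i ∈ T, (w i).1 = z.1 :=
      fun z => Finset.mem_image.1 z.2
    choose I hIT hI using hch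
    refine ⟨fun z => (w (I z)).2, fun T' _ => ?_⟩
    obtain ⟨g, hg, hgt⟩ := hT' (T.filter fun i => (w i).1 ∉ T') (Finset.filter_subset _ _)
    refine ⟨g, hg, fun z => ?_⟩
    have := hgt (I z) (hIT z)
    rw [Finset.mem_filter, hI] at this
    have hz := hIT z
    constructor
    · intro h; by_contra h'; exact (this.2 h').2 h
    · intro h; exact this.1 ⟨hz, h⟩
  have h1 : ((T.image fun i => (w i).1).card : ℕ∞) ≤ graphDim H :=
    le_iSup₂ (f := fun (S : Finset Z) (_ : GShatters H S) => (S.card : ℕ∞)) _ hsh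
  rw [hd, Finset.card_image_of_injOn hinj] at h1
  exact_mod_cast h1

/-! ### Chaining -/

/-- Massart's lemma: the expected maximum of finitely many sub-Gaussian variables. -/
theorem integral_sup'_le_sqrt {Ω β : Type*} [Finite Ω] [MeasurableSpace Ω]
    [MeasurableSingletonClass Ω] (μ : Measure Ω) [IsProbabilityMeasure μ] {B : Finset β}
    (hB : B.Nonempty) {Y : β → Ω → ℝ} {v : ℝ} (hv : 0 ≤ v)
    (h : ∀ b ∈ B, ∀ t : ℝ, ∫ ω, Real.exp (t * Y b ω) ∂μ ≤ Real.exp (t ^ 2 * v / 2)) :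
    ∫ ω, B.sup' hB (fun b => Y b ω) ∂μ ≤ √(2 * v * Real.log B.card) := by
  set E := ∫ ω, B.sup' hB (fun b => Y b ω) ∂μ with hE
  set L := Real.log B.card
  have hc : (1 : ℝ) ≤ B.card := by exact_mod_cast hB.card_pos
  have hL : 0 ≤ L := Real.log_nonneg hc
  have key : ∀ t : ℝ, 0 < t → t * E ≤ L + t ^ 2 * v / 2 := by
    intro t ht
    have h1 : Real.exp (t * E) ≤ ∫ ω, Real.exp (t * B.sup' hB fun b => Y b ω) ∂μ := by
      rw [hE, ← integral_const_mul]
      exact convexOn_exp.map_integral_le Real.continuous_exp.continuousOn isClosed_univ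
        (Filter.Eventually.of_forall fun _ => Set.mem_univ _) Integrable.of_finite
        Integrable.of_finite
    have h2 : ∀ ω, Real.exp (t * B.sup' hB fun b => Y b ω) ≤ ∑ b ∈ B, Real.exp (t * Y b ω) := by
      intro ω
      obtain ⟨b, hb, hbe⟩ := Finset.exists_mem_eq_sup' hB fun b => Y b ω
      rw [hbe]
      exact Finset.single_le_sum (f := fun b => Real.exp (t * Y b ω))
        (fun _ _ => (Real.exp_pos _).le) hb
    have h3 : Real.exp (t * E) ≤ B.card * Real.exp (t ^ 2 * v / 2) := by
      refine h1.trans ((integral_mono Integrable.of_finite Integrable.of_finite h2).trans ?_)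
      rw [integral_finsetSum _ fun _ _ => Integrable.of_finite]
      exact (Finset.sum_le_sum fun b hb => h b hb t).trans_eq (by simp)
    have h4 := Real.log_le_log (Real.exp_pos _) h3
    rwa [Real.log_exp, Real.log_mul (by positivity) (Real.exp_pos _).ne', Real.log_exp] at h4
  by_contra! hlt
  have hE0 : 0 < E := (Real.sqrt_nonneg _).trans_lt hlt
  have hE2 : 2 * v * L < E ^ 2 := (Real.sqrt_lt' hE0).1 hlt
  rcases hv.eq_or_lt with h0 | hpos
  · have := key ((L + 1) / E) (by positivity)
    rw [div_mul_cancel₀ _ hE0.ne', ← h0] at this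
    linarith
  · have := key (E / v) (by positivity)
    have e1 : E / v * E = E ^ 2 / v := by ring
    have e2 : (E / v) ^ 2 * v / 2 = E ^ 2 / v / 2 := by field_simp
    rw [e1, e2] at this
    have h5 : E ^ 2 / v ≤ 2 * L := by linarith
    rw [div_le_iff₀ hpos] at h5
    linarith

/-- Every finite family of finite sets has an `r`-separated subfamily that is an `r`-net. -/
theorem exists_separated_net {ι : Type*} [DecidableEq ι] (𝒜 : Finset (Finset ι)) (r : ℝ) :
    ∃ B ⊆ 𝒜, (∀ s ∈ B, ∀ t ∈ B, s ≠ t → r < ((s ∆ t).card : ℝ)) ∧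
      ∀ s ∈ 𝒜, s ∉ B → ∃ t ∈ B, ((s ∆ t).card : ℝ) ≤ r := by
  classical
  obtain ⟨B, hB, hmax⟩ := Finset.exists_max_image
    (𝒜.powerset.filter fun B => ∀ s ∈ B, ∀ t ∈ B, s ≠ t → r < ((s ∆ t).card : ℝ))
    Finset.card ⟨∅, by simp⟩
  rw [Finset.mem_filter, Finset.mem_powerset] at hB
  refine ⟨B, hB.1, hB.2, fun s hs hsB => ?_⟩
  by_contra! hcon
  have := hmax (insert s B) (by
    rw [Finset.mem_filter, Finset.mem_powerset]
    refine ⟨Finset.insert_subset hs hB.1, fun a ha b hb hab => ?_⟩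
    rcases Finset.mem_insert.1 ha with rfl | ha'
    · rcases Finset.mem_insert.1 hb with rfl | hb'
      · exact absurd rfl hab
      · exact hcon b hb'
    · rcases Finset.mem_insert.1 hb with rfl | hb'
      · rw [symmDiff_comm]; exact hcon a ha'
      · exact hB.2 a ha' b hb' hab)
  rw [Finset.card_insert_of_notMem hsB] at this
  omega

theorem sum_sub_sum_eq_sum_indicator {ι : Type*} [DecidableEq ι] [Fintype ι] (s t : Finset ι)
    (f : ι → ℝ) :
    ∑ i ∈ s, f i - ∑ i ∈ t, f i =
      ∑ i, ((if i ∈ s then 1 else 0) - (if i ∈ t then 1 else 0)) * f i := by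
  simp [sub_mul, Finset.sum_sub_distrib]

theorem sum_indicator_sub_sq {ι : Type*} [DecidableEq ι] [Fintype ι] (s t : Finset ι) :
    ∑ i, (((if i ∈ s then 1 else 0) - (if i ∈ t then 1 else 0)) ^ 2 : ℝ) = (s ∆ t).card := by
  have h : ∀ i, (((if i ∈ s then 1 else 0) - (if i ∈ t then 1 else 0)) ^ 2 : ℝ) =
      if i ∈ s ∆ t then 1 else 0 := by
    intro i
    by_cases hs : i ∈ s <;> by_cases ht : i ∈ t <;> simp [Finset.mem_symmDiff, hs, ht]
  simp_rw [h]
  simp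

theorem sqrt_half_pow (i : ℕ) : √(1 / 2) ^ i = √((1 / 2) ^ i) := by
  rw [← Real.sqrt_sq (by positivity : 0 ≤ √(1 / 2) ^ i), ← pow_mul, mul_comm i 2, pow_mul,
    Real.sq_sqrt (by norm_num)]

/-- The sum of the chaining increments is a geometric series of ratio `√(1 / 2)`. -/
theorem sum_sqrt_half_pow_le (J : ℕ) : ∑ i ∈ Finset.range J, √(1 / 2) ^ i ≤ 7 / 2 := by
  have hq : √(1 / 2) ≤ 5 / 7 := by
    rw [Real.sqrt_le_left (by norm_num)]; norm_num
  have hG : 0 ≤ ∑ i ∈ Finset.range J, √(1 / 2) ^ i := by positivity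
  have h1 := geom_sum_mul_neg √(1 / 2) J
  have h2 : 0 ≤ √(1 / 2) ^ J := by positivity
  nlinarith

theorem log_eight_mul_four_pow_le (j : ℕ) : Real.log (8 * 4 ^ j) ≤ 3 * 2 ^ j := by
  have h : (8 * 4 ^ j : ℝ) = 2 ^ (2 * j + 3) := by
    rw [pow_add, pow_mul]; norm_num; ring
  have h1 : (j : ℝ) + 1 ≤ 2 ^ j := by exact_mod_cast Nat.lt_two_pow_self
  have h2 : (1 : ℝ) ≤ 2 ^ j := one_le_pow₀ (by norm_num)
  rw [h, Real.log_pow]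
  push_cast
  nlinarith [Real.log_two_lt_d9, Real.log_two_gt_d9]

/-- The expected supremum of a sub-Gaussian process indexed by a family of sets of VC dimension `d`
is `O(√(n d))`, without a logarithmic factor. Chaining along nets of radius `n / 4 ^ i`: the
packing bound makes the increments decrease geometrically. -/
theorem integral_sup'_sum_le_of_vcDim {Ω ι : Type*} [Finite Ω] [MeasurableSpace Ω]
    [MeasurableSingletonClass Ω] (μ : Measure Ω) [IsProbabilityMeasure μ] [Fintype ι]
    [DecidableEq ι] {W : ι → Ω → ℝ}
    (hW : ∀ (a : ι → ℝ) (t : ℝ), ∫ ω, Real.exp (t * ∑ i, a i * W i ω) ∂μ ≤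
      Real.exp (t ^ 2 * (∑ i, a i ^ 2) / 2))
    {𝒜 : Finset (Finset ι)} (h𝒜 : 𝒜.Nonempty) {d : ℕ} (hd : 𝒜.vcDim ≤ d) :
    ∫ ω, 𝒜.sup' h𝒜 (fun s => ∑ i ∈ s, W i ω) ∂μ ≤ 18 * √(Fintype.card ι * d) := by
  set n : ℝ := (Fintype.card ι : ℝ) with hn
  have hn0 : 0 ≤ n := Nat.cast_nonneg _
  choose B hB𝒜 hsep hcov using fun i : ℕ => exists_separated_net 𝒜 (n / 4 ^ i)
  have hBne : ∀ i, (B i).Nonempty := by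
    intro i
    obtain ⟨s, hs⟩ := h𝒜
    by_cases hsB : s ∈ B i
    · exact ⟨s, hsB⟩
    · obtain ⟨t, ht, -⟩ := hcov i s hs hsB
      exact ⟨t, ht⟩
  have hnear : ∀ i, ∀ s ∈ 𝒜, ∃ t ∈ B i, ((s ∆ t).card : ℝ) ≤ n / 4 ^ i := by
    intro i s hs
    by_cases hsB : s ∈ B i
    · exact ⟨s, hsB, by simp; positivity⟩
    · exact hcov i s hs hsB
  set S : ℕ → ℝ := fun i => ∫ ω, (B i).sup' (hBne i) (fun s => ∑ i ∈ s, W i ω) ∂μ with hS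
  have hdiff : ∀ (s t : Finset ι) (c : ℝ), ∫ ω, Real.exp (c * (∑ i ∈ s, W i ω - ∑ i ∈ t, W i ω)) ∂μ
      ≤ Real.exp (c ^ 2 * (s ∆ t).card / 2) := by
    intro s t c
    simp_rw [sum_sub_sum_eq_sum_indicator]
    rw [← sum_indicator_sub_sq]
    exact hW _ c
  have hlog : ∀ i, Real.log (B i).card ≤ 6 * d * 2 ^ i := by
    intro i
    have h4 : (1 : ℝ) ≤ 4 ^ i := one_le_pow₀ (by norm_num)
    have := log_card_le_of_separated (B := B i)
      ((Finset.vcDim_mono (hB𝒜 i)).trans hd) (η := 1 / 4 ^ i) (by positivity)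
      (by rw [div_le_one (by positivity)]; exact h4) (fun s hs t ht hst => by
        rw [one_div_mul_eq_div]; exact (hsep i s hs t ht hst).le)
    rw [div_div_eq_mul_div, div_one] at this
    have h := mul_le_mul_of_nonneg_left (log_eight_mul_four_pow_le i)
      (by positivity : (0 : ℝ) ≤ 2 * d)
    linarith
  -- two subsets of `ι` are never more than `n` apart, so the coarsest net is a single set
  have hS0 : S 0 ≤ 0 := by
    have hcard : (B 0).card ≤ 1 := by
      refine Finset.card_le_one.2 fun s hs t ht => ?_
      by_contra hst
      have := hsep 0 s hs t ht hst
      rw [pow_zero, div_one, hn] at this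
      exact absurd (Finset.card_le_univ (s ∆ t)) (by exact_mod_cast not_le.2 this)
    have hlog0 : Real.log (B 0).card = 0 := by
      rw [le_antisymm hcard (hBne 0).card_pos]; simp
    have := integral_sup'_le_sqrt μ (hBne 0) (Y := fun s ω => ∑ i ∈ s, W i ω) (v := n) hn0
      fun s _ t => by
        refine (by simpa using hdiff s ∅ t : _ ≤ _).trans (Real.exp_le_exp.2 ?_)
        rw [show s ∆ ∅ = s from symmDiff_bot s]
        have : (s.card : ℝ) ≤ n := by rw [hn]; exact_mod_cast Finset.card_le_univ s
        have := mul_le_mul_of_nonneg_left this (sq_nonneg t)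
        linarith
    rwa [hlog0, mul_zero, Real.sqrt_zero] at this
  have hstep : ∀ i, S (i + 1) ≤ S i + √(24 * (n * d)) * √(1 / 2) ^ i := by
    intro i
    choose! π hπB hπ using hnear i
    have h1 : ∀ ω, (B (i + 1)).sup' (hBne (i + 1)) (fun s => ∑ i ∈ s, W i ω) ≤
        (B i).sup' (hBne i) (fun s => ∑ i ∈ s, W i ω) + (B (i + 1)).sup' (hBne (i + 1))
          (fun s => ∑ i ∈ s, W i ω - ∑ i ∈ π s, W i ω) := by
      intro ω
      refine Finset.sup'_le _ _ fun s hs => ?_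
      have a := Finset.le_sup' (fun s => ∑ i ∈ s, W i ω) (hπB s (hB𝒜 _ hs))
      have b := Finset.le_sup' (fun s => ∑ i ∈ s, W i ω - ∑ i ∈ π s, W i ω) hs
      linarith
    have h2 := integral_mono (μ := μ) Integrable.of_finite Integrable.of_finite h1
    rw [integral_add Integrable.of_finite Integrable.of_finite] at h2
    refine h2.trans (add_le_add_right ?_ _)
    refine (integral_sup'_le_sqrt μ (hBne (i + 1))
      (Y := fun s ω => ∑ i ∈ s, W i ω - ∑ i ∈ π s, W i ω) (v := n / 4 ^ i) (by positivity)
      fun s hs t => (hdiff s (π s) t).trans (Real.exp_le_exp.2 ?_)).trans ?_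
    · have := mul_le_mul_of_nonneg_left (hπ s (hB𝒜 _ hs)) (sq_nonneg t)
      linarith
    · rw [sqrt_half_pow, ← Real.sqrt_mul (by positivity)]
      refine Real.sqrt_le_sqrt ?_
      have := mul_le_mul_of_nonneg_left (hlog (i + 1)) (by positivity : 0 ≤ 2 * (n / 4 ^ i))
      refine this.trans_eq ?_
      rw [show (4 : ℝ) = 2 * 2 by norm_num, mul_pow, one_div_pow]
      field_simp
      ring
  have hSJ : ∀ J, S J ≤ √(24 * (n * d)) * ∑ i ∈ Finset.range J, √(1 / 2) ^ i := by
    intro J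
    induction J with
    | zero => simpa using hS0
    | succ J ih =>
      rw [Finset.sum_range_succ, mul_add]
      linarith [hstep J]
  -- below radius `1` the net is the whole family
  obtain ⟨J, hJ⟩ : ∃ J : ℕ, n / 4 ^ J < 1 := by
    obtain ⟨J, hJ⟩ := pow_unbounded_of_one_lt n (by norm_num : (1 : ℝ) < 4)
    exact ⟨J, by rwa [div_lt_one (by positivity)]⟩
  have hBJ : B J = 𝒜 := by
    refine (hB𝒜 J).antisymm fun s hs => ?_
    obtain ⟨t, ht, hst⟩ := hnear J s hs
    have h0 : (s ∆ t).card < 1 := by exact_mod_cast hst.trans_lt hJ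
    have : s ∆ t = ∅ := Finset.card_eq_zero.1 (by omega)
    rwa [symmDiff_eq_bot.1 this]
  have hfin := hSJ J
  simp only [hS, hBJ] at hfin
  refine hfin.trans ((mul_le_mul_of_nonneg_left (sum_sqrt_half_pow_le J)
    (Real.sqrt_nonneg _)).trans ?_)
  rw [Real.sqrt_mul (by norm_num)]
  have h24 : √24 ≤ 5 := by rw [Real.sqrt_le_left (by norm_num)]; norm_num
  have := Real.sqrt_nonneg (n * d)
  nlinarith

/-- The signs of `m` independent tuples of `k` fair coins are sub-Gaussian. -/
theorem integral_exp_sum_sgn_le {m k : ℕ} (a : Fin m × Fin k → ℝ) (t : ℝ) :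
    ∫ ω, Real.exp (t * ∑ i, a i * sgn (ω i.1 i.2)) ∂(Measure.pi fun _ : Fin m => coins k) ≤
      Real.exp (t ^ 2 * (∑ i, a i ^ 2) / 2) := by
  have h1 : ∀ ω : Fin m → Fin k → Bool, Real.exp (t * ∑ i, a i * sgn (ω i.1 i.2)) =
      ∏ i, ∏ j, Real.exp (t * a (i, j) * sgn (ω i j)) := by
    intro ω
    simp only [← Real.exp_sum, Fintype.sum_prod_type, Finset.mul_sum, mul_assoc]
  simp_rw [h1]
  rw [integral_fintype_prod_eq_prod (f := fun i (e : Fin k → Bool) =>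
    ∏ j, Real.exp (t * a (i, j) * sgn (e j)))]
  have h2 : ∀ i, ∫ e, ∏ j, Real.exp (t * a (i, j) * sgn (e j)) ∂coins k =
      ∏ j, Real.cosh (t * a (i, j)) := by
    intro i
    rw [integral_fintype_prod_eq_prod (f := fun j (b : Bool) =>
      Real.exp (t * a (i, j) * sgn b))]
    refine Finset.prod_congr rfl fun j _ => ?_
    rw [integral_coin, Real.cosh_eq]
    simp [sgn]
  simp_rw [h2]
  calc ∏ i, ∏ j, Real.cosh (t * a (i, j))
      ≤ ∏ i, ∏ j, Real.exp ((t * a (i, j)) ^ 2 / 2) :=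
        Finset.prod_le_prod (fun i _ => Finset.prod_nonneg fun j _ => (Real.cosh_pos _).le)
          fun i _ => Finset.prod_le_prod (fun j _ => (Real.cosh_pos _).le)
            fun j _ => Real.cosh_le_exp_half_sq _
    _ = _ := by
        simp only [← Real.exp_sum, Fintype.sum_prod_type, mul_pow, ← Finset.sum_div,
          ← Finset.mul_sum]

/-! ### The adversarial loss -/

theorem zeroOneLoss_mem_Icc {l : ℕ} (y' y : Fin l) : zeroOneLoss y' y ∈ Set.Icc (0 : ℝ) 1 := by
  unfold zeroOneLoss
  split_ifs <;> simp

theorem Mixture.loss_mem_Icc {Z : Type*} {l : ℕ} {H : Set (Z → Fin l)} (q : Mixture H) (z : Z)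
    (y : Fin l) : q.loss z y ∈ Set.Icc (0 : ℝ) 1 := by
  refine ⟨Finset.sum_nonneg fun t _ => mul_nonneg (q.α_mem t).1 (zeroOneLoss_mem_Icc _ _).1, ?_⟩
  rw [← q.α_sum]
  exact Finset.sum_le_sum fun t _ =>
    mul_le_of_le_one_right (q.α_mem t).1 (zeroOneLoss_mem_Icc _ _).2

theorem advLoss_mem_Icc {X Z : Type*} {l : ℕ} {H : Set (Z → Fin l)} (ρ : X → Finset Z)
    (hρ : ∀ x, (ρ x).Nonempty) (c : X → Fin l) (q : Mixture H) (x : X) :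
    advLoss ρ hρ c q x ∈ Set.Icc (0 : ℝ) 1 := by
  obtain ⟨z, -, hz⟩ := Finset.exists_mem_eq_sup' (hρ x) fun z => q.loss z (c x)
  rw [advLoss, hz]
  exact q.loss_mem_Icc _ _

/-- A nonempty finite set with at most `k` elements can be listed, with repetitions, by `Fin k`. -/
theorem exists_fin_enumeration {Z : Type*} {s : Finset Z} (hs : s.Nonempty) {k : ℕ}
    (hk : s.card ≤ k) : ∃ e : Fin k → Z, (∀ j, e j ∈ s) ∧ ∀ z ∈ s, ∃ j, e j = z := by
  obtain ⟨f⟩ : Nonempty (s ↪ Fin k) := Function.Embedding.nonempty_of_card_le (by simpa using hk)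
  have : Nonempty s := hs.to_subtype
  refine ⟨fun j => (Function.invFun f j).1, fun j => (Function.invFun f j).2, fun z hz => ?_⟩
  obtain ⟨j, hj⟩ := Function.invFun_surjective f.injective ⟨z, hz⟩
  exact ⟨j, congrArg Subtype.val hj⟩

/-- The maximum over the corruptions is Lipschitz in the vector of the losses at the corruptions. -/
theorem advLoss_sub_advLoss_le {X Z : Type*} {l k : ℕ} {H : Set (Z → Fin l)} (ρ : X → Finset Z)
    (hρ : ∀ x, (ρ x).Nonempty) (c : X → Fin l) {x : X} {e : Fin k → Z} (he : ∀ j, e j ∈ ρ x)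
    (he' : ∀ z ∈ ρ x, ∃ j, e j = z) (q q' : Mixture H) :
    advLoss ρ hρ c q x - advLoss ρ hρ c q' x ≤
      √(∑ j, (q.loss (e j) (c x) - q'.loss (e j) (c x)) ^ 2) := by
  obtain ⟨z, hz, hzq⟩ := Finset.exists_mem_eq_sup' (hρ x) fun z => q.loss z (c x)
  obtain ⟨j, rfl⟩ := he' z hz
  have h1 : q'.loss (e j) (c x) ≤ advLoss ρ hρ c q' x :=
    Finset.le_sup' (fun z => q'.loss z (c x)) (he j)
  have h2 : advLoss ρ hρ c q x = q.loss (e j) (c x) := hzq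
  refine Real.le_sqrt_of_sq_le ?_ |>.trans' (?_ : _ ≤ |q.loss (e j) (c x) - q'.loss (e j) (c x)|)
  · rw [sq_abs]
    exact Finset.single_le_sum
      (f := fun j => (q.loss (e j) (c x) - q'.loss (e j) (c x)) ^ 2)
      (fun _ _ => sq_nonneg _) (Finset.mem_univ j)
  · exact (by linarith : _ ≤ _).trans (le_abs_self _)

/-- A mixture enters a Rademacher sum linearly, so the sum is at most its maximum over the error
patterns of the hypotheses of `H`. -/
theorem sum_radSum_loss_le {Z : Type*} {l m k : ℕ} {H : Set (Z → Fin l)}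
    (w : Fin m × Fin k → Z × Fin l) (hne : (errorPatterns H w).Nonempty) (q : Mixture H)
    (ω : Fin m → Fin k → Bool) :
    ∑ i, radSum (fun j => q.loss (w (i, j)).1 (w (i, j)).2) (ω i) ≤
      (errorPatterns H w).sup' hne fun s => ∑ p ∈ s, sgn (ω p.1 p.2) := by
  classical
  have h1 : ∑ i, radSum (fun j => q.loss (w (i, j)).1 (w (i, j)).2) (ω i) =
      ∑ t, q.α t * ∑ p ∈ Finset.univ.filter fun p => q.h t (w p).1 ≠ (w p).2,
        sgn (ω p.1 p.2) := by
    simp only [radSum, Mixture.loss, zeroOneLoss, Finset.sum_filter, Finset.mul_sum]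
    rw [← Fintype.sum_prod_type', Finset.sum_comm]
    refine Finset.sum_congr rfl fun t _ => Finset.sum_congr rfl fun p _ => ?_
    split_ifs <;> ring
  rw [h1]
  calc _ ≤ ∑ t, q.α t * (errorPatterns H w).sup' hne fun s => ∑ p ∈ s, sgn (ω p.1 p.2) := by
        refine Finset.sum_le_sum fun t _ => mul_le_mul_of_nonneg_left ?_ (q.α_mem t).1
        exact Finset.le_sup' (fun s : Finset (Fin m × Fin k) => ∑ p ∈ s, sgn (ω p.1 p.2))
          (mem_errorPatterns.2 ⟨q.h t, q.h_mem t, fun p => by simp⟩)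
    _ = _ := by rw [← Finset.sum_mul, q.α_sum, one_mul]

/-! ### Uniform deviations -/

/-- The expected uniform deviation of a function of mixtures that is Lipschitz in the losses at `k`
points. The constant is `4` from symmetrization and contraction times `18` from chaining. -/
theorem integral_ciSup_deviation_le {X Z : Type*} [Countable X] [MeasurableSpace X]
    [DiscreteMeasurableSpace X] {l : ℕ} {H : Set (Z → Fin l)} [Nonempty (Mixture H)] {d : ℕ}
    (hd : graphDim H = d) {k : ℕ} (c : X → Fin l) (e : X → Fin k → Z) (D : Measure X)
    [IsProbabilityMeasure D] {φ : Mixture H → X → ℝ} (hφb : ∀ q x, |φ q x| ≤ 1)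
    (hφ : ∀ q q' x, φ q x - φ q' x ≤
      √(∑ j, (q.loss (e x j) (c x) - q'.loss (e x j) (c x)) ^ 2)) (m : ℕ) :
    ∫ s, ⨆ q, ∑ i, ((∫ x, φ q x ∂D) - φ q (s i)) ∂(Measure.pi fun _ : Fin m => D) ≤
      72 * √(m * k * d) := by
  have hv : ∀ (q : Mixture H) x j, |q.loss (e x j) (c x)| ≤ 1 := fun q x j => by
    have := q.loss_mem_Icc (e x j) (c x)
    rw [abs_of_nonneg this.1]; exact this.2
  set w : Mixture H → X × (Fin k → Bool) → ℝ :=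
    fun q p => 4 * radSum (fun j => q.loss (e p.1 j) (c p.1)) p.2 with hw
  have hwb : ∀ q p, |w q p| ≤ 4 * (k * 1) := fun q p => by
    rw [hw, abs_mul, abs_of_nonneg (by norm_num : (0 : ℝ) ≤ 4)]
    exact mul_le_mul_of_nonneg_left (abs_radSum_le (hv q p.1) p.2) (by norm_num)
  have h1 := integral_ciSup_sum_le D (D.prod (coins k))
    (g := fun q x => (∫ x', φ q x' ∂D) - φ q x) (w := w) (B := 1 + 1)
    (fun q x => by
      rw [sub_eq_add_neg]
      exact abs_add_le_of_le (abs_integral_le (hφb q)) (by rw [abs_neg]; exact hφb q x)) hwb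
    (fun F A hF => integral_ciSup_sub_le_radSum D
      (v := fun q x j => q.loss (e x j) (c x)) hφb hv hφ hF)
    m (fun _ => 0) 0 (fun _ => by simp)
  simp only [zero_add] at h1
  refine h1.trans ?_
  have hsum : ∀ (s : Fin m → X × (Fin k → Bool)) q, |∑ i, w q (s i)| ≤ m * (4 * (k * 1)) :=
    fun s q => abs_sum_fin_le fun i => hwb q (s i)
  have e1 := (measurePreserving_arrowProdEquivProdArrow X (Fin k → Bool) (Fin m)
    (fun _ => D) (fun _ => coins k)).symm
  rw [← e1.integral_comp', integral_prod_of_abs_le fun p => abs_ciSup_le (hsum _)]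
  have hx : ∀ x : Fin m → X, ∫ ω, ⨆ q, ∑ i, w q (x i, ω i) ∂(Measure.pi fun _ : Fin m => coins k) ≤
      72 * √(m * k * d) := by
    intro x
    set u : Fin m × Fin k → Z × Fin l := fun p => (e (x p.1) p.2, c (x p.1)) with hu
    obtain ⟨q₀⟩ := ‹Nonempty (Mixture H)›
    have : Nonempty (Mixture H) := ⟨q₀⟩
    have hT : Nonempty (Fin q₀.T) := by
      by_contra hcon
      rw [not_nonempty_iff] at hcon
      simpa using q₀.α_sum
    have hne : (errorPatterns H u).Nonempty := by
      classical
      exact ⟨Finset.univ.filter fun p => q₀.h hT.some (u p).1 ≠ (u p).2,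
        mem_errorPatterns.2 ⟨_, q₀.h_mem hT.some, fun p => by simp⟩⟩
    have h2 := integral_sup'_sum_le_of_vcDim (Measure.pi fun _ : Fin m => coins k)
      (W := fun (p : Fin m × Fin k) ω => sgn (ω p.1 p.2)) integral_exp_sum_sgn_le hne
      (vcDim_errorPatterns_le u hd)
    rw [Fintype.card_prod, Fintype.card_fin, Fintype.card_fin, Nat.cast_mul] at h2
    have h3 : ∀ ω : Fin m → Fin k → Bool, (⨆ q, ∑ i, w q (x i, ω i)) ≤
        4 * (errorPatterns H u).sup' hne fun s => ∑ p ∈ s, sgn (ω p.1 p.2) := by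
      intro ω
      refine ciSup_le fun q => ?_
      rw [hw]
      simp only
      rw [← Finset.mul_sum]
      exact mul_le_mul_of_nonneg_left (sum_radSum_loss_le u hne q ω) (by norm_num)
    have h4 := integral_mono (μ := Measure.pi fun _ : Fin m => coins k)
      Integrable.of_finite Integrable.of_finite h3
    rw [integral_const_mul] at h4
    linarith
  refine (integral_mono (integrable_of_abs_le fun x => abs_integral_le fun ω =>
    abs_ciSup_le (hsum _)) (integrable_const (72 * √(m * k * d))) hx).trans (by simp)

/-- One-sided uniform deviations, with high probability. -/
theorem measureReal_exists_deviation_le {X Z : Type*} [Countable X] [MeasurableSpace X]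
    [DiscreteMeasurableSpace X] {l : ℕ} {H : Set (Z → Fin l)} [Nonempty (Mixture H)] {d : ℕ}
    (hd : graphDim H = d) {k : ℕ} (c : X → Fin l) (e : X → Fin k → Z) (D : Measure X)
    [IsProbabilityMeasure D] {φ : Mixture H → X → ℝ} (hφb : ∀ q x, |φ q x| ≤ 1)
    (hφ1 : ∀ q x y, φ q x - φ q y ≤ 1)
    (hφ : ∀ q q' x, φ q x - φ q' x ≤
      √(∑ j, (q.loss (e x j) (c x) - q'.loss (e x j) (c x)) ^ 2)) {m : ℕ} (hm : 0 < m)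
    {ε : ℝ} (hε : 0 < ε) (hmd : 144 ^ 2 * (k * d) ≤ m * ε ^ 2) :
    (Measure.pi fun _ : Fin m => D).real
        {s | ∃ q, m * ε < ∑ i, ((∫ x, φ q x ∂D) - φ q (s i))} ≤
      Real.exp (-(m * ε ^ 2 / 2)) := by
  have hm' : (0 : ℝ) < m := by exact_mod_cast hm
  have hb : ∀ (s : Fin m → X) q, |∑ i, ((∫ x, φ q x ∂D) - φ q (s i))| ≤ m * (1 + 1) :=
    fun s q => abs_sum_fin_le fun i => by
      rw [sub_eq_add_neg]
      exact abs_add_le_of_le (abs_integral_le (hφb q)) (by rw [abs_neg]; exact hφb q _)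
  have hE := integral_ciSup_deviation_le hd c e D hφb hφ m
  have hsqrt : 72 * √(m * k * d) ≤ m * ε / 2 := by
    have : √(m * k * d) ≤ m * ε / 144 := by
      rw [Real.sqrt_le_left (by positivity)]
      have := mul_le_mul_of_nonneg_left hmd hm'.le
      nlinarith
    linarith
  have key := measureReal_add_le_bounded_differences D hm
    (f := fun s => ⨆ q, ∑ i, ((∫ x, φ q x ∂D) - φ q (s i))) (fun s => abs_ciSup_le (hb s))
    (fun s i x => by
      rw [sub_le_iff_le_add]
      refine ciSup_le fun q => ?_
      have h1 := le_ciSup_of_abs_le (hb (Function.update s i x)) q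
      have h2 : ∑ j, ((∫ x, φ q x ∂D) - φ q (s j)) -
          ∑ j, ((∫ x, φ q x ∂D) - φ q (Function.update s i x j)) = φ q x - φ q (s i) := by
        rw [← Finset.sum_sub_distrib, Finset.sum_eq_single i]
        · simp
        · intro j _ hj; simp [Function.update_of_ne hj]
        · simp
      linarith [hφ1 q x (s i)]) (a := m * ε / 2) (by positivity)
  have hexp : 2 * (m * ε / 2) ^ 2 / m = m * ε ^ 2 / 2 := by field_simp
  rw [hexp] at key
  refine (measureReal_mono ?_).trans key
  rintro s ⟨q, hq⟩
  have := le_ciSup_of_abs_le (hb s) q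
  simp only [Set.mem_ofPred_eq]
  linarith

/-- The sample size bounds the expected deviation and the tail. The factor `1 / 2` in front of `δ`,
which the union bound over the two signs needs, costs a term `log 2`: for `d ≥ 1` it is absorbed by
`k log k d`, and for `d = 0` by `log (1 / δ)`, as `δ ≤ 1 / 2` there. -/
theorem sample_size_bounds {d k m : ℕ} (hk : 2 ≤ k) {ε δ : ℝ} (hε : 0 < ε) (hδ : 0 < δ)
    (hδ1 : δ < 1) (hdδ : 1 ≤ d ∨ δ ≤ 1 / 2)
    (hm : 40000 * (1 / ε ^ 2 * (k * Real.log k * d + Real.log (1 / δ))) ≤ m) :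
    0 < m ∧ 144 ^ 2 * ((k : ℝ) * d) ≤ m * ε ^ 2 ∧ Real.exp (-(m * ε ^ 2 / 2)) ≤ δ / 2 := by
  have hk' : (2 : ℝ) ≤ k := by exact_mod_cast hk
  have hlogk : 0.69 ≤ Real.log k :=
    (by linarith [Real.log_two_gt_d9] : (0.69 : ℝ) ≤ Real.log 2).trans
      (Real.log_le_log (by norm_num) hk')
  have hlogδ : 0 < Real.log (1 / δ) := Real.log_pos (by rw [lt_div_iff₀ hδ]; linarith)
  have hd0 : (0 : ℝ) ≤ d := Nat.cast_nonneg d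
  have hkd : 0 ≤ (k : ℝ) * d := by positivity
  have hA : (k : ℝ) * d * 0.69 ≤ k * Real.log k * d := by nlinarith
  have hmε : 40000 * (k * Real.log k * d + Real.log (1 / δ)) ≤ m * ε ^ 2 := by
    have := mul_le_mul_of_nonneg_right hm (sq_nonneg ε)
    refine le_trans (le_of_eq ?_) this
    field_simp
  have hlog2 : Real.log 2 ≤ k * Real.log k * d + Real.log (1 / δ) := by
    rcases hdδ with h | h
    · have h1 : (1 : ℝ) ≤ d := by exact_mod_cast h
      have : 2 ≤ (k : ℝ) * d := by nlinarith
      linarith [Real.log_two_lt_d9]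
    · have : Real.log 2 ≤ Real.log (1 / δ) :=
        Real.log_le_log (by norm_num) (by rw [le_div_iff₀ hδ]; linarith)
      linarith
  refine ⟨?_, by linarith, ?_⟩
  · have : 0 < (m : ℝ) * ε ^ 2 := by linarith
    rcases Nat.eq_zero_or_pos m with rfl | h
    · simp at this
    · exact h
  · have h2 : Real.log (2 / δ) ≤ m * ε ^ 2 / 2 := by
      rw [Real.log_div (by norm_num) hδ.ne']
      rw [one_div, Real.log_inv] at *
      linarith
    calc Real.exp (-(m * ε ^ 2 / 2)) ≤ Real.exp (-Real.log (2 / δ)) := by gcongr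
      _ = δ / 2 := by rw [Real.exp_neg, Real.exp_log (by positivity), inv_div]

end AdvRobust

theorem mainTheorem3 :
    ∃ C : ℝ, 0 < C ∧
      ∀ {X Z : Type*} [Countable X] [MeasurableSpace X] [DiscreteMeasurableSpace X]
        (l : ℕ) (H : Set (Z → Fin l)) (d : ℕ) (_hd : AdvRobust.graphDim H = (d : ℕ∞))
        (k : ℕ) (_hk : 2 ≤ k)
        (ρ : X → Finset Z) (hρ : ∀ x, (ρ x).Nonempty) (_hρk : ∀ x, (ρ x).card ≤ k)
        (c : X → Fin l) (D : Measure X) [IsProbabilityMeasure D]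
        (ε δ : ℝ) (_hε : 0 < ε) (_hδ : 0 < δ) (_hδ1 : δ < 1) (_hdδ : 1 ≤ d ∨ δ ≤ 1 / 2)
        (m : ℕ) (_hm : C * (1 / ε ^ 2 * (k * Real.log k * d + Real.log (1 / δ))) ≤ m),
        1 - δ ≤ (Measure.pi fun _ : Fin m => D).real
          {s : Fin m → X | ∀ q : AdvRobust.Mixture H,
            |AdvRobust.risk D ρ hρ c q - AdvRobust.empRisk ρ hρ c s q| ≤ ε} := by
  -- `40000 * log 2` exceeds the `144 ^ 2` that comes from symmetrization and chaining
  refine ⟨40000, by norm_num, ?_⟩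
  intro X Z _ _ _ l H d hd k hk ρ hρ hρk c D _ ε δ hε hδ hδ1 hdδ m hm
  obtain ⟨hm0, hmd, hexp⟩ := AdvRobust.sample_size_bounds hk hε hδ hδ1 hdδ hm
  have hm' : (0 : ℝ) < m := by exact_mod_cast hm0
  -- there are no mixtures if `H` is empty
  rcases isEmpty_or_nonempty (AdvRobust.Mixture H) with hE | hE
  · simp only [IsEmpty.forall_iff, Set.ofPred_true, probReal_univ]
    linarith
  choose e he he' using fun x => AdvRobust.exists_fin_enumeration (hρ x) (hρk x)
  have hadv := fun q x => AdvRobust.advLoss_mem_Icc (H := H) ρ hρ c q x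
  have hup := AdvRobust.measureReal_exists_deviation_le hd c e D
    (φ := fun q x => AdvRobust.advLoss ρ hρ c q x)
    (fun q x => abs_le.2 ⟨by linarith [(hadv q x).1], (hadv q x).2⟩)
    (fun q x y => by linarith [(hadv q x).2, (hadv q y).1])
    (fun q q' x => AdvRobust.advLoss_sub_advLoss_le ρ hρ c (he x) (he' x) q q') hm0 hε hmd
  have hdown := AdvRobust.measureReal_exists_deviation_le hd c e D
    (φ := fun q x => -AdvRobust.advLoss ρ hρ c q x)
    (fun q x => by
      rw [abs_neg]; exact abs_le.2 ⟨by linarith [(hadv q x).1], (hadv q x).2⟩)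
    (fun q x y => by linarith [(hadv q y).2, (hadv q x).1])
    (fun q q' x => by
      have := AdvRobust.advLoss_sub_advLoss_le ρ hρ c (he x) (he' x) q' q
      simp_rw [sub_sq_comm (q'.loss _ _)] at this
      linarith) hm0 hε hmd
  set P := Measure.pi fun _ : Fin m => D
  set A := {s : Fin m → X | ∃ q : AdvRobust.Mixture H, m * ε <
    ∑ i, ((∫ x, AdvRobust.advLoss ρ hρ c q x ∂D) - AdvRobust.advLoss ρ hρ c q (s i))}
  set B := {s : Fin m → X | ∃ q : AdvRobust.Mixture H, m * ε <
    ∑ i, ((∫ x, -AdvRobust.advLoss ρ hρ c q x ∂D) - -AdvRobust.advLoss ρ hρ c q (s i))}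
  have hAB : P.real (A ∪ B) ≤ δ :=
    (measureReal_union_le A B).trans (by linarith)
  have hcompl : P.real (A ∪ B)ᶜ = 1 - P.real (A ∪ B) :=
    probReal_compl_eq_one_sub (Set.to_countable _).measurableSet
  refine (by linarith : 1 - δ ≤ P.real (A ∪ B)ᶜ).trans (measureReal_mono fun s hs q => ?_)
  rw [Set.mem_compl_iff, Set.mem_union, not_or] at hs
  have h1 : ∑ i, ((∫ x, AdvRobust.advLoss ρ hρ c q x ∂D) - AdvRobust.advLoss ρ hρ c q (s i)) ≤
      m * ε := le_of_not_gt fun h => hs.1 ⟨q, h⟩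
  have h2 : ∑ i, ((∫ x, -AdvRobust.advLoss ρ hρ c q x ∂D) - -AdvRobust.advLoss ρ hρ c q (s i)) ≤
      m * ε := le_of_not_gt fun h => hs.2 ⟨q, h⟩
  rw [integral_neg] at h2
  simp only [Finset.sum_sub_distrib, Finset.sum_neg_distrib, Finset.sum_const, Finset.card_univ,
    Fintype.card_fin, nsmul_eq_mul] at h1 h2
  have h3 : m * AdvRobust.empRisk ρ hρ c s q = ∑ i, AdvRobust.advLoss ρ hρ c q (s i) := by
    rw [AdvRobust.empRisk]; field_simp
  have h4 : AdvRobust.risk D ρ hρ c q = ∫ x, AdvRobust.advLoss ρ hρ c q x ∂D := rfl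
  rw [← h3, ← h4] at h1 h2
  rw [abs_le]
  constructor
  · refine le_of_mul_le_mul_left ?_ hm'
    linarith
  · refine le_of_mul_le_mul_left ?_ hm'
    linarith
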